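/- Let $K\in\mathbb N$, let $\mathcal X$ be a set, let $\mathcal Y=\{-1,1\}^K$, and let $\ell:\mathcal Y\times\mathcal Y\to\mathbb R_{\ge 0}$ be any loss function satisfying the identity of indiscernibles, i.e. $\ell(y_1,y_2)=0$ if and only if $y_1=y_2$. Let $\mathcal F\subseteq\mathcal Y^{\mathcal X}$ be a non-empty function class and, for $k\in\{1,\dots,K\}$, let $\mathcal F_k=\{f_k : (f_1,\dots,f_K)\in\mathcal F\}\subseteq\{-1,1\}^{\mathcal X}$ be its restriction to the $k$-th coordinate. **Online learning.** Let $\mathcal Z$ be a finite label space, $\mathcal H\subseteq\mathcal Z^{\mathcal X}$ and $\lambda:\mathcal Z\times\mathcal Z\to\mathbb R_{\ge0}$ a loss. A learner and an adversary play $T$ rounds, $T$ being known to the learner. In round $t$ the adversary selects a labelled instance $(x_t,z_t)\in\mathcal X\times\mathcal Z$ and reveals $x_t$; the learner makes a (possibly randomized) prediction $\hat z_t\in\mathcal Z$, based on $x_t$ and on what it has seen in the past rounds, and suffers the loss $\lambda(\hat z_t,z_t)$. Under *full feedback* the learner is then shown $z_t$; under *bandit feedback* it is shown only the number $\lambda(\hat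 z_t,z_t)$. An *adaptive* adversary draws $(x_t,z_t)$ from a discrete probability distribution that may depend on all instances, labels and predictions of the past rounds; an *oblivious* adversary plays a sequence $(x_1,z_1),\dots,(x_T,z_T)$ fixed in advance. The class $\mathcal H$ is *online learnable* w.r.t. $\lambda$ (respectively *bandit online learnable* w.r.t. $\lambda$) against one of these two kinds of adversary if there are a randomized learner under full (respectively bandit) feedback and a positive, non-decreasing function $R$ of $T\in\mathbb N$ with $R(T)/T\to0$ such that, for every $T$ and every adversary of that kind, $$\mathbb E\left[\sum_{t=1}^T\lambda(\hat z_t,z_t)-\inf_{h\in\mathcal H}\sum_{t=1}^T\lambda(h(x_t),z_t)\right]\le R(T),$$ where the expectation is over the randomness of the learner and of the adversary. **Theorem.** The class $\mathcal F$ is bandit online learnable w.r.t. $\ell$ if and only if for every $k\in\{1,\dots,K\}$ the restriction $\mathcal F_k$ is online learnable (under full feedback) w.r.t. the $0$-$1$ loss $(a,b)\mapsto\mathbb 1\{a\ne b\}$. This equivalence holds when learnability is understood, on both sides, against adaptive adversaries, and also when it is understood, on both sides, against oblivious adversaries. -/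

import Mathlib

open scoped Asymptotics

noncomputable section

namespace OnlineLearning

/-- The label space `{-1, 1}^K`; the units of `ℤ` are exactly `1` and `-1`. -/
abbrev MultiLabel (K : ℕ) : Type := Fin K → ℤˣ

/-- A real loss vanishes exactly on the diagonal. -/
def IdentityOfIndiscernibles {Y : Type*} (loss : Y → Y → ℝ) : Prop :=
  ∀ y₁ y₂ : Y, loss y₁ y₂ = 0 ↔ y₁ = y₂

open Classical in
/-- The 0-1 loss. -/
def zeroOneLoss {Y : Type*} (y₁ y₂ : Y) : ℝ := if y₁ = y₂ then 0 else 1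

/-- The restriction `F_k = {f_k : f ∈ F}` of a multilabel class to its `k`-th coordinate. -/
def coordClass {X : Type*} {K : ℕ} (F : Set (X → MultiLabel K)) (k : Fin K) : Set (X → ℤˣ) :=
  {g | ∃ f ∈ F, g = fun x => f x k}

/-- What happened in one round: the instance and the label chosen by the adversary, and the
prediction drawn by the learner. -/
structure Round (X Y : Type*) where
  inst : X
  label : Y
  pred : Y

/-- A randomized learner under full feedback: from the complete record of the past rounds
(earliest first; the true labels have been revealed) and the current instance, it produces the
distribution of its next prediction. -/
abbrev Learner (X Y : Type*) := List (Round X Y) → X → PMF Y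

/-- What a learner under bandit feedback knows of a past round: the instance, its own prediction,
and the loss it suffered; not the label. -/
structure BanditRound (X Y : Type*) where
  inst : X
  pred : Y
  lossValue : ℝ

/-- A randomized learner under bandit feedback. -/
abbrev BanditLearner (X Y : Type*) := List (BanditRound X Y) → X → PMF Y

/-- The part of a round that is visible under bandit feedback. -/
def Round.toBandit {X Y : Type*} (loss : Y → Y → ℝ) (r : Round X Y) : BanditRound X Y where
  inst := r.inst
  pred := r.pred
  lossValue := loss r.pred r.label

/-- A bandit learner, run in the game: it is shown the bandit view of the past only. -/
def BanditLearner.toLearner {X Y : Type*} (loss : Y → Y → ℝ) (B : BanditLearner X Y) :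
    Learner X Y :=
  fun h x => B (h.map (Round.toBandit loss)) x

/-- A randomized adaptive adversary: from the complete record of the past rounds, including the
learner's past predictions, it produces the distribution of the next labelled instance. -/
abbrev Adversary (X Y : Type*) := List (Round X Y) → PMF (X × Y)

/-- All adversaries. -/
def adaptiveAdversaries (X Y : Type*) : Set (Adversary X Y) := Set.univ

/-- The oblivious adversaries: they play a sequence of labelled instances fixed in advance. -/
def obliviousAdversaries (X Y : Type*) : Set (Adversary X Y) :=
  {D | ∃ s : ℕ → X × Y, ∀ h : List (Round X Y), D h = PMF.pure (s h.length)}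

/-- The law of the record of the first `T` rounds. In each round the adversary draws `(x, y)` and
the learner draws its prediction knowing the past and `x`; given the past and `x`, the prediction
is independent of `y`. -/
def gameLaw {X Y : Type*} (A : Learner X Y) (D : Adversary X Y) : ℕ → PMF (List (Round X Y))
  | 0 => PMF.pure []
  | T + 1 => (gameLaw A D T).bind fun h =>
      (D h).bind fun z =>
        (A h z.1).map fun p => h ++ [⟨z.1, z.2, p⟩]

/-- The regret of the learner on a record of the game:
`∑ ℓ(ŷ_t, y_t) - inf_{f ∈ F} ∑ ℓ(f(x_t), y_t)`. -/
def regret {X Y : Type*} (loss : Y → Y → ℝ) (F : Set (X → Y)) (h : List (Round X Y)) : ℝ :=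
  (h.map fun r => loss r.pred r.label).sum -
    ⨅ f : F, (h.map fun r => loss (f.1 r.inst) r.label).sum

/-- The expected regret after `T` rounds, over the randomness of both players. -/
def expectedRegret {X Y : Type*} (loss : Y → Y → ℝ) (F : Set (X → Y))
    (A : Learner X Y) (D : Adversary X Y) (T : ℕ) : ℝ :=
  ∑' h : List (Round X Y), (gameLaw A D T h).toReal * regret loss F h

/-- A positive, non-decreasing, sublinear function of the number of rounds. -/
structure IsRegretBound (R : ℕ → ℝ) : Prop where
  pos : ∀ T, 0 < R T
  mono : Monotone R
  sublinear : R =o[Filter.atTop] fun T : ℕ => (T : ℝ)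

/-- Online learnability of `F` with respect to a loss under full feedback, against the adversaries
of the class `C`. The learner is told the number `T` of rounds. -/
def OnlineLearnable {X Y : Type*} (C : Set (Adversary X Y)) (loss : Y → Y → ℝ)
    (F : Set (X → Y)) : Prop :=
  ∃ (A : ℕ → Learner X Y) (R : ℕ → ℝ), IsRegretBound R ∧
    ∀ T : ℕ, ∀ D ∈ C, expectedRegret loss F (A T) D T ≤ R T

/-- Online learnability of `F` with respect to a loss under bandit feedback, against the
adversaries of the class `C`. The learner is told the number `T` of rounds. -/
def BanditOnlineLearnable {X Y : Type*} (C : Set (Adversary X Y)) (loss : Y → Y → ℝ)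
    (F : Set (X → Y)) : Prop :=
  ∃ (B : ℕ → BanditLearner X Y) (R : ℕ → ℝ), IsRegretBound R ∧
    ∀ T : ℕ, ∀ D ∈ C, expectedRegret loss F ((B T).toLearner loss) D T ≤ R T

end OnlineLearning

end

/-! Everything passes through one property that mentions neither loss, feedback nor adversary: for
every horizon `T` there are polynomially many experts, each predicting from the instances seen so
far, such that every member of the class agrees with some expert along any instance sequence of
length `T` (`HasPolyCover`).

Learnability forces covers. If the class shatters trees of every depth (with distinct labels on the
two edges at a node), an oblivious adversary walks down a tree of depth `T`, always choosing the
label that the learner predicts less often; the expected loss is linear in `T` while some member of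
the class errs nowhere (`exists_not_shatters_of_onlineLearnable`). If some depth is not shattered,
Littlestone's argument gives the experts (`exists_covers_of_not_shatters`).

Covers force bandit learnability against every adversary. Exponential weights over the experts, with
uniform exploration and importance-weighted loss estimates, has sublinear regret, because its regret
is at most of order a power of `T` below one times the logarithm of the number of experts
(`expectedRegret_exponentialWeights_le`). Against an adaptive adversary the infimum stands inside
the expectation, so unbiased estimates alone do not suffice; a second log-sum-exp term in the
potential controls all experts' deviations at once (`potential_step`).

Covers of `F` project to each coordinate, and covers of the finitely many coordinates multiply to a
cover of `F`. This gives the equivalence for both kinds of adversary. -/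

namespace OnlineLearning

/-! ### Expectations under discrete distributions -/

section Expectation

variable {α β : Type*}

/-- The expectation of a real function under a discrete distribution. -/
noncomputable def expect (μ : PMF α) (g : α → ℝ) : ℝ := ∑' a, (μ a).toReal * g a

/-- Boundedness on the support of a discrete distribution. -/
def BddOnSupport (μ : PMF α) (g : α → ℝ) : Prop := ∃ B, ∀ a ∈ μ.support, |g a| ≤ B

theorem summable_toReal (μ : PMF α) : Summable fun a => (μ a).toReal :=
  ENNReal.summable_toReal μ.tsum_coe_ne_top

theorem tsum_toReal (μ : PMF α) : ∑' a, (μ a).toReal = 1 := by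
  rw [← ENNReal.tsum_toReal_eq fun a => μ.apply_ne_top a, μ.tsum_coe, ENNReal.toReal_one]

theorem abs_toReal_mul_le {μ : PMF α} {g : α → ℝ} {B : ℝ} (h : ∀ a ∈ μ.support, |g a| ≤ B)
    (a : α) : |(μ a).toReal * g a| ≤ (μ a).toReal * B := by
  by_cases ha : μ a = 0
  · simp [ha]
  · rw [abs_mul, abs_of_nonneg ENNReal.toReal_nonneg]
    exact mul_le_mul_of_nonneg_left (h a ((μ.mem_support_iff a).2 ha)) ENNReal.toReal_nonneg

/-- Total mass one makes boundedness sufficient. The hypothesis recurs below because a divergent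
`tsum` has the default value 0. -/
theorem BddOnSupport.summable {μ : PMF α} {g : α → ℝ} (hg : BddOnSupport μ g) :
    Summable fun a => (μ a).toReal * g a := by
  obtain ⟨B, hB⟩ := hg
  exact Summable.of_norm_bounded ((summable_toReal μ).mul_right B) (abs_toReal_mul_le hB)

theorem expect_const (μ : PMF α) (c : ℝ) : expect μ (fun _ => c) = c := by
  rw [expect, tsum_mul_right, tsum_toReal, one_mul]

theorem bddOnSupport_const (μ : PMF α) (c : ℝ) : BddOnSupport μ fun _ => c :=
  ⟨|c|, fun _ _ => le_rfl⟩

theorem expect_congr {μ : PMF α} {f g : α → ℝ} (h : ∀ a ∈ μ.support, f a = g a) :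
    expect μ f = expect μ g := by
  refine tsum_congr fun a => ?_
  by_cases ha : μ a = 0
  · simp [ha]
  · rw [h a ((μ.mem_support_iff a).2 ha)]

theorem expect_mono {μ : PMF α} {f g : α → ℝ} (hf : BddOnSupport μ f) (hg : BddOnSupport μ g)
    (h : ∀ a ∈ μ.support, f a ≤ g a) : expect μ f ≤ expect μ g := by
  refine hf.summable.tsum_le_tsum (fun a => ?_) hg.summable
  by_cases ha : μ a = 0
  · simp [ha]
  · exact mul_le_mul_of_nonneg_left (h a ((μ.mem_support_iff a).2 ha)) ENNReal.toReal_nonneg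

theorem expect_add {μ : PMF α} {f g : α → ℝ} (hf : BddOnSupport μ f) (hg : BddOnSupport μ g) :
    expect μ (fun a => f a + g a) = expect μ f + expect μ g := by
  simp only [expect, mul_add]
  exact hf.summable.tsum_add hg.summable

theorem expect_mul_left (μ : PMF α) (c : ℝ) (g : α → ℝ) :
    expect μ (fun a => c * g a) = c * expect μ g := by
  simp only [expect, ← tsum_mul_left]
  exact tsum_congr fun a => by ring

theorem BddOnSupport.add {μ : PMF α} {f g : α → ℝ} (hf : BddOnSupport μ f)
    (hg : BddOnSupport μ g) : BddOnSupport μ (fun a => f a + g a) := by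
  obtain ⟨B, hB⟩ := hf
  obtain ⟨C, hC⟩ := hg
  exact ⟨B + C, fun a ha => (abs_add_le _ _).trans (add_le_add (hB a ha) (hC a ha))⟩

theorem abs_expect_le {μ : PMF α} {g : α → ℝ} {B : ℝ} (h : ∀ a ∈ μ.support, |g a| ≤ B) :
    |expect μ g| ≤ B := by
  have hg : BddOnSupport μ g := ⟨B, h⟩
  rw [abs_le]
  constructor
  · rw [← expect_const μ (-B)]
    exact expect_mono (bddOnSupport_const μ _) hg fun a ha => (abs_le.1 (h a ha)).1
  · rw [← expect_const μ B]
    exact expect_mono hg (bddOnSupport_const μ _) fun a ha => (abs_le.1 (h a ha)).2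

theorem expect_pure (a : α) (g : α → ℝ) : expect (PMF.pure a) g = g a := by
  rw [expect, tsum_eq_single a fun b hb => by simp [PMF.pure_apply, hb]]
  simp

theorem expect_bind {μ : PMF α} {κ : α → PMF β} {g : β → ℝ} (hg : BddOnSupport (μ.bind κ) g) :
    expect (μ.bind κ) g = expect μ fun a => expect (κ a) g := by
  obtain ⟨B, hB⟩ := hg
  have hsum : Summable fun p : α × β => (μ p.1 * κ p.1 p.2).toReal := by
    refine ENNReal.summable_toReal ?_
    rw [ENNReal.tsum_prod']
    simp [ENNReal.tsum_mul_left, PMF.tsum_coe]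
  have hall : Summable fun p : α × β => (μ p.1).toReal * ((κ p.1 p.2).toReal * g p.2) := by
    refine Summable.of_norm_bounded (hsum.mul_right B) fun p => ?_
    rw [← mul_assoc, ← ENNReal.toReal_mul, Real.norm_eq_abs, abs_mul,
      abs_of_nonneg ENNReal.toReal_nonneg]
    by_cases hp : μ p.1 * κ p.1 p.2 = 0
    · simp [hp]
    · refine mul_le_mul_of_nonneg_left (hB p.2 ?_) ENNReal.toReal_nonneg
      rw [PMF.mem_support_bind_iff]
      exact ⟨p.1, left_ne_zero_of_mul hp, right_ne_zero_of_mul hp⟩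
  have hswap := Summable.tsum_comm (f := fun a b => (μ a).toReal * ((κ a b).toReal * g b)) hall
  simp only [expect, ← tsum_mul_left]
  rw [← hswap]
  refine tsum_congr fun b => ?_
  rw [PMF.bind_apply, ENNReal.tsum_toReal_eq fun a =>
    ENNReal.mul_ne_top (μ.apply_ne_top a) ((κ a).apply_ne_top b), ← tsum_mul_right]
  exact tsum_congr fun a => by rw [ENNReal.toReal_mul, mul_assoc]

theorem expect_map (μ : PMF α) (f : α → β) {g : β → ℝ} (hg : BddOnSupport (μ.map f) g) :
    expect (μ.map f) g = expect μ fun a => g (f a) := by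
  rw [PMF.map] at hg ⊢
  simp only [expect_bind hg, Function.comp_apply, expect_pure]

theorem expect_fintype [Fintype α] (μ : PMF α) (g : α → ℝ) :
    expect μ g = ∑ a, (μ a).toReal * g a := tsum_fintype _

theorem bddOnSupport_of_fintype [Fintype α] (μ : PMF α) (g : α → ℝ) : BddOnSupport μ g :=
  ⟨∑ a, |g a|, fun a _ => Finset.single_le_sum (f := fun a => |g a|)
    (fun _ _ => abs_nonneg _) (Finset.mem_univ a)⟩

end Expectation

/-! ### Expectations along the game -/

section Game

variable {X Y : Type*}

/-- A function of records that is bounded on the records of each given length. -/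
def LengthBounded (V : List (Round X Y) → ℝ) : Prop :=
  ∀ n, ∃ B, ∀ h : List (Round X Y), h.length = n → |V h| ≤ B

theorem length_of_mem_support_gameLaw {A : Learner X Y} {D : Adversary X Y} {T : ℕ}
    {h : List (Round X Y)} (hh : h ∈ (gameLaw A D T).support) : h.length = T := by
  induction T generalizing h with
  | zero => simpa [gameLaw] using hh
  | succ T ih =>
    simp only [gameLaw, PMF.mem_support_bind_iff, PMF.mem_support_map_iff] at hh
    obtain ⟨h', hh', z, -, p, -, rfl⟩ := hh
    simp [ih hh']

theorem LengthBounded.bddOnSupport {V : List (Round X Y) → ℝ} (hV : LengthBounded V)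
    (A : Learner X Y) (D : Adversary X Y) (T : ℕ) : BddOnSupport (gameLaw A D T) V := by
  obtain ⟨B, hB⟩ := hV T
  exact ⟨B, fun h hh => hB h (length_of_mem_support_gameLaw hh)⟩

theorem expect_gameLaw_succ {V : List (Round X Y) → ℝ} (hV : LengthBounded V)
    (A : Learner X Y) (D : Adversary X Y) (T : ℕ) :
    expect (gameLaw A D (T + 1)) V = expect (gameLaw A D T) fun h =>
      expect (D h) fun z => expect (A h z.1) fun p => V (h ++ [⟨z.1, z.2, p⟩]) := by
  have hb := hV.bddOnSupport A D (T + 1)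
  obtain ⟨B, hB⟩ := hV (T + 1)
  rw [gameLaw] at hb ⊢
  rw [expect_bind hb]
  refine expect_congr fun h hh => ?_
  have hl := length_of_mem_support_gameLaw hh
  rw [expect_bind]
  · refine expect_congr fun z _ => expect_map _ _ ⟨B, fun h' hh' => hB h' ?_⟩
    obtain ⟨p, -, rfl⟩ := (PMF.mem_support_map_iff _ _ _).1 hh'
    simp [hl]
  · refine ⟨B, fun h' hh' => hB h' ?_⟩
    simp only [PMF.mem_support_bind_iff, PMF.mem_support_map_iff] at hh'
    obtain ⟨z, -, p, -, rfl⟩ := hh'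
    simp [hl]

/-- A potential that increases by at most `ε` per round in conditional expectation. -/
theorem expect_gameLaw_le {V : List (Round X Y) → ℝ} (hV : LengthBounded V)
    (A : Learner X Y) (D : Adversary X Y) {ε : ℝ}
    (hstep : ∀ h x y, expect (A h x) (fun p => V (h ++ [⟨x, y, p⟩])) ≤ V h + ε) (T : ℕ) :
    expect (gameLaw A D T) V ≤ V [] + T * ε := by
  induction T with
  | zero => simp [gameLaw, expect_pure]
  | succ T ih =>
    have hV' := hV.bddOnSupport A D T
    obtain ⟨B, hB⟩ := hV (T + 1)
    rw [expect_gameLaw_succ hV]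
    have hB' : ∀ h ∈ (gameLaw A D T).support, ∀ x y,
        |expect (A h x) (fun p => V (h ++ [⟨x, y, p⟩]))| ≤ B := fun h hh x y =>
      abs_expect_le fun p _ => hB _ (by simp [length_of_mem_support_gameLaw hh])
    calc _ ≤ expect (gameLaw A D T) fun h => V h + ε := by
            refine expect_mono ⟨B, fun h hh => abs_expect_le fun z _ => hB' h hh _ _⟩
              (hV'.add (bddOnSupport_const _ _)) fun h hh => ?_
            -- `hstep` holds for every instance and label, hence survives averaging over any draw of
            -- the adversary.
            rw [← expect_const (D h) (V h + ε)]
            exact expect_mono ⟨B, fun z _ => hB' h hh _ _⟩ (bddOnSupport_const _ _)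
              fun z _ => hstep h z.1 z.2
      _ = expect (gameLaw A D T) V + ε := by
            rw [expect_add hV' (bddOnSupport_const _ _), expect_const]
      _ ≤ V [] + T * ε + ε := by gcongr
      _ = _ := by push_cast; ring

/-- The cumulative loss of the learner. -/
def cumLoss (loss : Y → Y → ℝ) (h : List (Round X Y)) : ℝ :=
  (h.map fun r => loss r.pred r.label).sum

theorem cumLoss_append (loss : Y → Y → ℝ) (h : List (Round X Y)) (r : Round X Y) :
    cumLoss loss (h ++ [r]) = cumLoss loss h + loss r.pred r.label := by
  simp [cumLoss]

theorem sum_map_mem_Icc {α : Type*} {g : α → ℝ} {L : ℝ} (h0 : ∀ a, 0 ≤ g a) (hL : ∀ a, g a ≤ L)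
    (l : List α) : 0 ≤ (l.map g).sum ∧ (l.map g).sum ≤ l.length * L := by
  induction l with
  | nil => simp
  | cons a l ih =>
    simp only [List.map_cons, List.sum_cons, List.length_cons, Nat.cast_add, Nat.cast_one]
    constructor <;> nlinarith [h0 a, hL a]

theorem lengthBounded_cumLoss {loss : Y → Y → ℝ} {L : ℝ} (h0 : ∀ a b, 0 ≤ loss a b)
    (hL : ∀ a b, loss a b ≤ L) : LengthBounded (X := X) (cumLoss loss) := by
  refine fun n => ⟨n * L, fun h hh => ?_⟩
  have := sum_map_mem_Icc (g := fun r : Round X Y => loss r.pred r.label) (fun _ => h0 _ _)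
    (fun _ => hL _ _) h
  rw [hh] at this
  rw [cumLoss, abs_of_nonneg this.1]
  exact this.2

theorem lengthBounded_regret {loss : Y → Y → ℝ} {L : ℝ} (h0 : ∀ a b, 0 ≤ loss a b)
    (hL : ∀ a b, loss a b ≤ L) {F : Set (X → Y)} (hF : F.Nonempty) :
    LengthBounded (regret loss F) := by
  intro n
  refine ⟨n * L, fun h hh => ?_⟩
  have h1 := sum_map_mem_Icc (g := fun r : Round X Y => loss r.pred r.label) (fun _ => h0 _ _)
    (fun _ => hL _ _) h
  have h2 : ∀ f : X → Y, _ := fun f => sum_map_mem_Icc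
    (g := fun r : Round X Y => loss (f r.inst) r.label) (fun _ => h0 _ _) (fun _ => hL _ _) h
  rw [hh] at h1 h2
  obtain ⟨f, hf⟩ := hF
  have : Nonempty F := ⟨⟨f, hf⟩⟩
  have h3 : 0 ≤ ⨅ f : F, (h.map fun r => loss (f.1 r.inst) r.label).sum :=
    le_ciInf fun f => (h2 f.1).1
  have h4 : (⨅ f : F, (h.map fun r => loss (f.1 r.inst) r.label).sum) ≤ n * L :=
    (ciInf_le ⟨0, by rintro _ ⟨f, rfl⟩; exact (h2 f.1).1⟩ (⟨f, hf⟩ : F)).trans (h2 f).2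
  rw [regret, abs_le]
  constructor <;> linarith

end Game

/-! ### Shattered trees and the lower bound -/

section Littlestone

variable {X Y : Type*}

/-- The class `F` shatters a complete binary tree of depth `d` whose nodes are labelled by
instances and whose two outgoing edges at each node are labelled by distinct labels. -/
def Shatters : ℕ → Set (X → Y) → Prop
  | 0, F => F.Nonempty
  | d + 1, F => ∃ x y y', y ≠ y' ∧ Shatters d {f ∈ F | f x = y} ∧ Shatters d {f ∈ F | f x = y'}

theorem Shatters.mono {d : ℕ} {F G : Set (X → Y)} (hF : Shatters d F) (h : F ⊆ G) :
    Shatters d G := by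
  induction d generalizing F G with
  | zero => exact Set.Nonempty.mono h hF
  | succ d ih =>
    obtain ⟨x, y, y', hne, h1, h2⟩ := hF
    exact ⟨x, y, y', hne, ih h1 fun f hf => ⟨h hf.1, hf.2⟩, ih h2 fun f hf => ⟨h hf.1, hf.2⟩⟩

/-- The oblivious adversary that plays the sequence `s`. -/
noncomputable def playSequence (s : ℕ → X × Y) : Adversary X Y := fun h => PMF.pure (s h.length)

/-- This lets an oblivious sequence be built round by round: choosing a later entry leaves the law
of the earlier rounds unchanged. -/
theorem gameLaw_playSequence_congr (A : Learner X Y) {s s' : ℕ → X × Y} {n : ℕ}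
    (h : ∀ t < n, s t = s' t) :
    gameLaw A (playSequence s) n = gameLaw A (playSequence s') n := by
  induction n with
  | zero => rfl
  | succ n ih =>
    simp only [gameLaw]
    rw [ih fun t ht => h t (by omega)]
    ext r
    simp only [PMF.bind_apply _ _ r]
    refine tsum_congr fun a => ?_
    by_cases ha : gameLaw A (playSequence s') n a = 0
    · simp [ha]
    · have hl := length_of_mem_support_gameLaw ((PMF.mem_support_iff _ a).2 ha)
      simp only [playSequence, hl, h n (by omega)]

/-- Given the past, the prediction costs at least `c` unless it hits the label `(s n).2`; then
average over the past. -/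
theorem expect_cumLoss_succ_ge {loss : Y → Y → ℝ} {c L : ℝ} (h0 : ∀ a b, 0 ≤ loss a b)
    (hL : ∀ a b, loss a b ≤ L) (hc : ∀ a b, a ≠ b → c ≤ loss a b) (hc0 : 0 ≤ c) [Finite Y]
    (A : Learner X Y) (s : ℕ → X × Y) (n : ℕ) :
    expect (gameLaw A (playSequence s) n) (cumLoss loss) +
        c * (1 - expect (gameLaw A (playSequence s) n) fun h => (A h (s n).1 (s n).2).toReal) ≤
      expect (gameLaw A (playSequence s) (n + 1)) (cumLoss loss) := by
  classical
  have := Fintype.ofFinite Y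
  have hV : LengthBounded (X := X) (cumLoss loss) := lengthBounded_cumLoss h0 hL
  have hb := hV.bddOnSupport A (playSequence s) n
  set μ := gameLaw A (playSequence s) n with hμ
  rw [expect_gameLaw_succ hV, ← hμ]
  have hq : BddOnSupport μ fun h => -(c * (A h (s n).1 (s n).2).toReal) := by
    refine ⟨c, fun h _ => ?_⟩
    rw [abs_neg, abs_of_nonneg (mul_nonneg hc0 ENNReal.toReal_nonneg)]
    have : (A h (s n).1 (s n).2).toReal ≤ 1 :=
      ENNReal.toReal_le_of_le_ofReal zero_le_one (by simpa using PMF.coe_le_one _ _)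
    nlinarith
  have hlin : expect μ (cumLoss loss) + c * (1 - expect μ fun h => (A h (s n).1 (s n).2).toReal) =
      expect μ fun h => (cumLoss loss h + c) + -(c * (A h (s n).1 (s n).2).toReal) := by
    rw [expect_add (hb.add (bddOnSupport_const _ _)) hq, expect_add hb (bddOnSupport_const _ _),
      expect_const]
    have : (expect μ fun h => -(c * (A h (s n).1 (s n).2).toReal)) =
        -c * expect μ fun h => (A h (s n).1 (s n).2).toReal := by
      rw [← expect_mul_left]
      simp only [neg_mul]
    rw [this]
    ring
  rw [hlin]
  obtain ⟨B, hB⟩ := hV (n + 1)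
  refine expect_mono ((hb.add (bddOnSupport_const _ _)).add hq)
    ⟨B, fun h hh => abs_expect_le fun z _ => abs_expect_le fun p _ => hB _ ?_⟩ fun h hh => ?_
  · simp [length_of_mem_support_gameLaw hh]
  · have hl := length_of_mem_support_gameLaw hh
    simp only [playSequence, expect_pure, hl, cumLoss_append]
    rw [expect_add (bddOnSupport_const _ _) (bddOnSupport_of_fintype _ _), expect_const, add_assoc]
    gcongr
    have h1 : c + -(c * (A h (s n).1 (s n).2).toReal) =
        expect (A h (s n).1) fun p => c + (if p = (s n).2 then -c else 0) := by
      rw [expect_add (bddOnSupport_of_fintype _ _) (bddOnSupport_of_fintype _ _), expect_const,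
        expect_fintype]
      simp [mul_comm]
    rw [h1]
    refine expect_mono (bddOnSupport_of_fintype _ _) (bddOnSupport_of_fintype _ _) fun p _ => ?_
    split_ifs with hp
    · simpa using h0 _ _
    · simpa using hc _ _ hp

/-- Walk down the tree, at each node taking the edge whose label has the smaller average probability
of being predicted. That average is over the learner's own past randomness, so the choice needs no
observation of predictions and the adversary stays oblivious. Each round costs at least `c / 2`. The
prefix of length `n` is what the induction on depth carries along. -/
theorem Shatters.exists_hard_sequence {loss : Y → Y → ℝ} {c L : ℝ} (h0 : ∀ a b, 0 ≤ loss a b)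
    (hL : ∀ a b, loss a b ≤ L) (hc : ∀ a b, a ≠ b → c ≤ loss a b) (hc0 : 0 ≤ c) [Finite Y]
    (A : Learner X Y) {d : ℕ} {F : Set (X → Y)} (hF : Shatters d F) (n : ℕ) (s₀ : ℕ → X × Y) :
    ∃ s : ℕ → X × Y, (∀ t < n, s t = s₀ t) ∧
      (∃ f ∈ F, ∀ t, n ≤ t → t < n + d → f (s t).1 = (s t).2) ∧
      expect (gameLaw A (playSequence s₀) n) (cumLoss loss) + c * d / 2 ≤
        expect (gameLaw A (playSequence s) (n + d)) (cumLoss loss) := by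
  classical
  have := Fintype.ofFinite Y
  induction d generalizing F n s₀ with
  | zero =>
    obtain ⟨f, hf⟩ := hF
    exact ⟨s₀, fun _ _ => rfl, ⟨f, hf, fun t h1 h2 => by omega⟩, by simp⟩
  | succ d ih =>
    obtain ⟨x, y, y', hne, h1, h2⟩ := hF
    set μ := gameLaw A (playSequence s₀) n with hμ
    have hbd : ∀ y, BddOnSupport μ fun h => (A h x y).toReal := fun y => by
      refine ⟨1, fun h _ => ?_⟩
      rw [abs_of_nonneg ENNReal.toReal_nonneg]
      exact ENNReal.toReal_le_of_le_ofReal zero_le_one (by simpa using PMF.coe_le_one _ _)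
    -- The two edge labels are distinct, so their probabilities add up to at most one and one of
    -- them is at most `1 / 2`.
    have hsum : (expect μ fun h => (A h x y).toReal) + (expect μ fun h => (A h x y').toReal) ≤ 1 := by
      rw [← expect_add (hbd y) (hbd y'), ← expect_const μ 1]
      refine expect_mono ((hbd y).add (hbd y')) (bddOnSupport_const _ _) fun h _ => ?_
      have := Finset.sum_le_univ_sum_of_nonneg (s := {y, y'})
        (fun b => ENNReal.toReal_nonneg (a := A h x b))
      rwa [Finset.sum_pair hne, ← tsum_fintype (L := .unconditional _), tsum_toReal] at this
    obtain ⟨z, hz, hzq⟩ : ∃ z, Shatters d {f ∈ F | f x = z} ∧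
        (expect μ fun h => (A h x z).toReal) ≤ 1 / 2 := by
      rcases le_total (expect μ fun h => (A h x y).toReal) (expect μ fun h => (A h x y').toReal)
        with h | h
      · exact ⟨y, h1, by linarith⟩
      · exact ⟨y', h2, by linarith⟩
    have hs₁ : ∀ t < n, Function.update s₀ n (x, z) t = s₀ t := fun t ht =>
      Function.update_of_ne (by omega) _ _
    obtain ⟨s, hs, ⟨f, hf, hft⟩, hloss⟩ := ih hz (n + 1) (Function.update s₀ n (x, z))
    have hsn : s n = (x, z) := by simpa using hs n (by omega)
    refine ⟨s, fun t ht => (hs t (by omega)).trans (hs₁ t ht), ⟨f, hf.1, fun t ht1 ht2 => ?_⟩, ?_⟩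
    · rcases ht1.eq_or_lt with rfl | ht
      · rw [hsn]
        exact hf.2
      · exact hft t ht (by omega)
    · have hstep := expect_cumLoss_succ_ge (X := X) h0 hL hc hc0 A (Function.update s₀ n (x, z)) n
      rw [gameLaw_playSequence_congr A hs₁, ← hμ] at hstep
      simp only [Function.update_self] at hstep
      rw [show n + (d + 1) = n + 1 + d by omega]
      push_cast
      nlinarith

theorem label_eq_of_mem_support_gameLaw {A : Learner X Y} {s : ℕ → X × Y} {f : X → Y} {T : ℕ}
    (hf : ∀ t < T, f (s t).1 = (s t).2) {h : List (Round X Y)}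
    (hh : h ∈ (gameLaw A (playSequence s) T).support) : ∀ r ∈ h, f r.inst = r.label := by
  induction T generalizing h with
  | zero =>
    have : h = [] := by simpa [gameLaw] using hh
    simp [this]
  | succ T ih =>
    simp only [gameLaw, PMF.mem_support_bind_iff, PMF.mem_support_map_iff] at hh
    obtain ⟨h', hh', z, hz, p, -, rfl⟩ := hh
    have hl := length_of_mem_support_gameLaw hh'
    have hz' : z = s T := by simpa [playSequence, hl] using hz
    intro r hr
    rcases List.mem_append.1 hr with hr | hr
    · exact ih (fun t ht => hf t (by omega)) hh' r hr
    · rw [List.mem_singleton.1 hr, hz']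
      exact hf T (by omega)

/-- A class that shatters trees of every depth is not learnable. -/
theorem exists_not_shatters_of_onlineLearnable [Finite Y] {loss : Y → Y → ℝ}
    (h0 : ∀ a b, 0 ≤ loss a b) (hi : IdentityOfIndiscernibles loss) {F : Set (X → Y)}
    (hF : OnlineLearnable (obliviousAdversaries X Y) loss F) : ∃ d, ¬ Shatters d F := by
  classical
  have := Fintype.ofFinite Y
  by_contra! hall
  obtain ⟨A, R, hR, hA⟩ := hF
  obtain ⟨L, hL⟩ : ∃ L, ∀ a b, loss a b ≤ L := by
    obtain ⟨L, hL⟩ := (Set.finite_range fun p : Y × Y => loss p.1 p.2).bddAbove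
    exact ⟨L, fun a b => hL ⟨(a, b), rfl⟩⟩
  -- `c` is the least loss off the diagonal; a shattered tree of depth 1 supplies two distinct
  -- labels, so the minimum is over a nonempty set.
  obtain ⟨c, hc0, hc⟩ : ∃ c > 0, ∀ a b, a ≠ b → c ≤ loss a b := by
    obtain ⟨x, y, y', hne, -⟩ := hall 1
    have hne' : ({p : Y × Y | p.1 ≠ p.2}).Nonempty := ⟨(y, y'), hne⟩
    obtain ⟨p, hp, hmin⟩ := Set.exists_min_image {p : Y × Y | p.1 ≠ p.2}
      (fun p => loss p.1 p.2) (Set.toFinite _) hne'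
    exact ⟨loss p.1 p.2, lt_of_le_of_ne (h0 _ _) fun h => hp ((hi _ _).1 h.symm),
      fun a b hab => hmin (a, b) hab⟩
  have hlow : ∀ T : ℕ, c * T / 2 ≤ R T := fun T => by
    obtain ⟨x, y, -⟩ := hall 1
    obtain ⟨s, -, ⟨f, hf, hfs⟩, hs⟩ :=
      (hall T).exists_hard_sequence h0 hL hc hc0.le (A T) 0 fun _ => (x, y)
    simp only [zero_le, zero_add, true_implies] at hfs hs
    have hD : playSequence s ∈ obliviousAdversaries X Y := ⟨s, fun _ => rfl⟩
    -- Some member of `F` realizes the whole sequence, so the comparator vanishes and regret is the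
    -- cumulative loss.
    have hreg : expect (gameLaw (A T) (playSequence s) T) (cumLoss loss) =
        expectedRegret loss F (A T) (playSequence s) T := by
      refine expect_congr fun h hh => ?_
      have hlab := label_eq_of_mem_support_gameLaw hfs hh
      have hinf : (⨅ f : F, (h.map fun r => loss (f.1 r.inst) r.label).sum) = 0 := by
        have hpos : ∀ f : F, 0 ≤ (h.map fun r => loss (f.1 r.inst) r.label).sum := fun f =>
          (sum_map_mem_Icc (fun _ => h0 _ _) (fun _ => hL _ _) h).1
        have : Nonempty F := ⟨⟨f, hf⟩⟩
        refine le_antisymm ((ciInf_le ⟨0, by rintro _ ⟨f, rfl⟩; exact hpos f⟩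
          (⟨f, hf⟩ : F)).trans_eq ?_) (le_ciInf hpos)
        refine List.sum_eq_zero fun a ha => ?_
        obtain ⟨r, hr, rfl⟩ := List.mem_map.1 ha
        exact (hi _ _).2 (hlab r hr)
      rw [regret, hinf, sub_zero, cumLoss]
    have := hA T _ hD
    rw [← hreg] at this
    simp only [gameLaw, expect_pure, cumLoss, List.map_nil, List.sum_nil, zero_add] at hs
    exact hs.trans this
  -- `R T ≤ (c / 4) T` contradicts `c T / 2 ≤ R T` once `T ≥ 1`.
  obtain ⟨T, hT, hT1⟩ := ((hR.sublinear.bound (by positivity : 0 < c / 4)).and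
    (Filter.eventually_ge_atTop 1)).exists
  have hT1' : (1 : ℝ) ≤ T := by exact_mod_cast hT1
  have := hlow T
  rw [Real.norm_of_nonneg (hR.pos T).le, Real.norm_of_nonneg (by positivity)] at hT
  nlinarith

end Littlestone

/-! ### Covers by polynomially many experts -/

section Cover

variable {X Y : Type*}

/-- The experts `E i`, which predict from the past instances and the current one, cover the class
`F` on sequences of length `T`: each member of `F` is followed by some expert. -/
def Covers {ι : Type*} (E : ι → List X → X → Y) (F : Set (X → Y)) (T : ℕ) : Prop :=
  ∀ f ∈ F, ∀ xs : List X, xs.length = T → ∃ i, ∀ l x, l ++ [x] <+: xs → E i l x = f x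

/-- There are covers whose size is polynomial in the number of rounds. -/
def HasPolyCover (F : Set (X → Y)) : Prop :=
  ∃ C d : ℕ, ∀ T : ℕ, ∃ (ι : Type) (_ : Fintype ι) (_ : Nonempty ι) (E : ι → List X → X → Y),
    Fintype.card ι ≤ (C * (T + 1)) ^ d ∧ Covers E F T

/-- The number of experts used for `T` rounds when no tree of depth `d` is shattered. -/
def coverSize (q : ℕ) : ℕ → ℕ → ℕ
  | 0, _ => 1
  | _ + 1, 0 => 1
  | T + 1, d + 1 => coverSize q T (d + 1) + q * coverSize q T d

theorem coverSize_pos (q T d : ℕ) : 0 < coverSize q T d := by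
  induction T with
  | zero => simp [coverSize]
  | succ T ih =>
    cases d with
    | zero => simp [coverSize]
    | succ d => simp only [coverSize]; omega

theorem coverSize_le {q : ℕ} (hq : 1 ≤ q) (T d : ℕ) : coverSize q T d ≤ (q * (T + 1)) ^ d := by
  induction T generalizing d with
  | zero => simpa [coverSize] using Nat.one_le_pow _ _ hq
  | succ T ih =>
    cases d with
    | zero => simp [coverSize]
    | succ d =>
      calc coverSize q T (d + 1) + q * coverSize q T d
          ≤ (q * (T + 1)) ^ (d + 1) + q * (q * (T + 1)) ^ d :=
            add_le_add (ih _) (Nat.mul_le_mul_left _ (ih _))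
        _ = (q * (T + 1)) ^ d * (q * (T + 1 + 1)) := by ring
        _ ≤ (q * (T + 1 + 1)) ^ d * (q * (T + 1 + 1)) := by gcongr; omega
        _ = _ := by rw [pow_succ]

/-- At the first instance at most one label keeps the tree depth from dropping. An expert either
bets on that label and continues with a cover for the same depth, or bets on some label and
continues with a cover for depth `d`; this is the recursion of `coverSize`. A class not shattering
depth 0 is empty. -/
theorem exists_covers_of_not_shatters [Fintype Y] [Nonempty Y] (T d : ℕ) (F : Set (X → Y))
    (hF : ¬ Shatters d F) :
    ∃ E : Fin (coverSize (Fintype.card Y) T d) → List X → X → Y, Covers E F T := by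
  classical
  induction T generalizing d F with
  | zero =>
    refine ⟨fun _ _ _ => Classical.arbitrary Y, fun f _ xs hxs => ⟨⟨0, coverSize_pos _ _ _⟩, ?_⟩⟩
    intro l x hl
    have := hl.length_le
    simp [hxs] at this
  | succ T ih =>
    cases d with
    | zero => exact ⟨fun _ _ _ => Classical.arbitrary Y, fun f hf => (hF ⟨f, hf⟩).elim⟩
    | succ d =>
      -- Two labels whose subclasses both shatter depth `d` would give a tree of depth `d + 1`
      -- rooted at `x`.
      have hmaj : ∀ x, ∃ y₀, ∀ y, y ≠ y₀ → ¬ Shatters d {f ∈ F | f x = y} := fun x => by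
        by_cases h : ∃ y, Shatters d {f ∈ F | f x = y}
        · obtain ⟨y, hy⟩ := h
          exact ⟨y, fun y' hne hy' => hF ⟨x, y', y, hne, hy', hy⟩⟩
        · exact ⟨Classical.arbitrary Y, fun y _ hy => h ⟨y, hy⟩⟩
      choose y₀ hy₀ using hmaj
      choose E₁ hE₁ using fun x y => ih (d + 1) {f ∈ F | f x = y}
        fun h => hF (h.mono fun f hf => hf.1)
      -- The experts are junk at `y = y₀ x`, where no cover of depth `d` is available and none is
      -- needed.
      have hE₂ : ∀ x y, ∃ E : Fin (coverSize (Fintype.card Y) T d) → List X → X → Y,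
          y ≠ y₀ x → Covers E {f ∈ F | f x = y} T := fun x y => by
        by_cases hy : y = y₀ x
        · exact ⟨fun _ _ _ => y, fun h => (h hy).elim⟩
        · obtain ⟨E, hE⟩ := ih d _ (hy₀ x y hy)
          exact ⟨E, fun _ => hE⟩
      choose E₂ hE₂ using hE₂
      let E : Fin (coverSize (Fintype.card Y) T (d + 1)) ⊕
          Y × Fin (coverSize (Fintype.card Y) T d) → List X → X → Y := fun i l x =>
        match i, l with
        | .inl _, [] => y₀ x
        | .inr j, [] => j.1
        | .inl i, x₁ :: l => E₁ x₁ (y₀ x₁) i l x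
        | .inr j, x₁ :: l => E₂ x₁ j.1 j.2 l x
      have hcard : Fintype.card (Fin (coverSize (Fintype.card Y) T (d + 1)) ⊕
          Y × Fin (coverSize (Fintype.card Y) T d)) =
          coverSize (Fintype.card Y) (T + 1) (d + 1) := by
        simp [coverSize]
      let e := (Fintype.equivFinOfCardEq hcard).symm
      refine ⟨fun i => E (e i), fun f hf xs hxs => ?_⟩
      suffices h : ∃ i, ∀ l x, l ++ [x] <+: xs → E i l x = f x by
        obtain ⟨i, hi⟩ := h
        exact ⟨e.symm i, by simpa using hi⟩
      obtain ⟨x₁, xs, rfl⟩ := List.exists_cons_of_length_eq_add_one hxs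
      by_cases hy : f x₁ = y₀ x₁
      · obtain ⟨i, hi⟩ := hE₁ x₁ (y₀ x₁) f ⟨hf, hy⟩ xs (by simpa using hxs)
        refine ⟨.inl i, fun l x hl => ?_⟩
        cases l with
        | nil =>
          obtain ⟨rfl, -⟩ := List.cons_prefix_cons.1 hl
          exact hy.symm
        | cons a l =>
          obtain ⟨rfl, hl'⟩ := List.cons_prefix_cons.1 hl
          exact hi l x hl'
      · obtain ⟨i, hi⟩ := hE₂ x₁ (f x₁) hy f ⟨hf, rfl⟩ xs (by simpa using hxs)
        refine ⟨.inr (f x₁, i), fun l x hl => ?_⟩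
        cases l with
        | nil =>
          obtain ⟨rfl, -⟩ := List.cons_prefix_cons.1 hl
          rfl
        | cons a l =>
          obtain ⟨rfl, hl'⟩ := List.cons_prefix_cons.1 hl
          exact hi l x hl'

theorem hasPolyCover_of_not_shatters [Finite Y] [Nonempty Y] {d : ℕ} {F : Set (X → Y)}
    (hF : ¬ Shatters d F) : HasPolyCover F := by
  have := Fintype.ofFinite Y
  refine ⟨Fintype.card Y, d, fun T => ?_⟩
  obtain ⟨E, hE⟩ := exists_covers_of_not_shatters T d F hF
  exact ⟨_, inferInstance, ⟨⟨0, coverSize_pos _ _ _⟩⟩, E,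
    by simpa using coverSize_le Fintype.card_pos T d, hE⟩

theorem HasPolyCover.coordClass {K : ℕ} {F : Set (X → MultiLabel K)} (hF : HasPolyCover F)
    (k : Fin K) : HasPolyCover (coordClass F k) := by
  obtain ⟨C, d, h⟩ := hF
  refine ⟨C, d, fun T => ?_⟩
  obtain ⟨ι, i1, i2, E, hcard, hE⟩ := h T
  refine ⟨ι, i1, i2, fun i l x => E i l x k, hcard, ?_⟩
  rintro _ ⟨f, hf, rfl⟩ xs hxs
  obtain ⟨i, hi⟩ := hE f hf xs hxs
  exact ⟨i, fun l x hl => congrFun (hi l x hl) k⟩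

/-- Take all tuples of coordinate experts: cardinalities multiply, so the exponents add over the
finitely many coordinates. -/
theorem hasPolyCover_of_coordClass {K : ℕ} {F : Set (X → MultiLabel K)}
    (hF : ∀ k, HasPolyCover (coordClass F k)) : HasPolyCover F := by
  classical
  choose C d h using hF
  refine ⟨∑ k, C k, ∑ k, d k, fun T => ?_⟩
  choose ι i1 i2 E hcard hE using fun k => h k T
  refine ⟨∀ k, ι k, inferInstance, inferInstance, fun i l x k => E k (i k) l x, ?_, ?_⟩
  · rw [Fintype.card_pi, ← Finset.prod_pow_eq_pow_sum]
    refine Finset.prod_le_prod' fun k _ => (hcard k).trans ?_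
    gcongr
    exact Finset.single_le_sum (f := C) (fun _ _ => Nat.zero_le _) (Finset.mem_univ k)
  · intro f hf xs hxs
    choose i hi using fun k => hE k (fun x => f x k) ⟨f, hf, rfl⟩ xs hxs
    exact ⟨i, fun l x hl => funext fun k => hi k l x hl⟩

end Cover

/-! ### Exponential weights with exploration: one round -/

section ExponentialWeights

variable {ι Y : Type*} [Fintype ι]

/-- The probability weights proportional to `exp (u i)`. -/
noncomputable def gibbs (u : ι → ℝ) (i : ι) : ℝ := Real.exp (u i) / ∑ j, Real.exp (u j)

theorem sum_exp_pos [Nonempty ι] (u : ι → ℝ) : 0 < ∑ i, Real.exp (u i) :=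
  Finset.sum_pos (fun _ _ => Real.exp_pos _) Finset.univ_nonempty

theorem gibbs_nonneg (u : ι → ℝ) (i : ι) : 0 ≤ gibbs u i :=
  div_nonneg (Real.exp_pos _).le (Finset.sum_nonneg fun _ _ => (Real.exp_pos _).le)

theorem sum_gibbs [Nonempty ι] (u : ι → ℝ) : ∑ i, gibbs u i = 1 := by
  simp only [gibbs, ← Finset.sum_div]
  exact div_self (sum_exp_pos u).ne'

/-- Combine `exp v ≤ 1 + v + v ^ 2` for `|v| ≤ 1` with `log z ≤ z - 1` applied to the ratio of the
two sums. -/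
theorem log_sum_exp_add_le [Nonempty ι] (u v : ι → ℝ) {δ : ℝ} (h1 : ∀ i, |v i| ≤ 1)
    (hδ : ∀ i, v i ^ 2 ≤ δ) :
    Real.log (∑ i, Real.exp (u i + v i)) ≤
      Real.log (∑ i, Real.exp (u i)) + (∑ i, gibbs u i * v i + δ) := by
  have hu := sum_exp_pos u
  have huv := sum_exp_pos fun i => u i + v i
  have hratio : (∑ i, Real.exp (u i + v i)) / (∑ i, Real.exp (u i)) =
      ∑ i, gibbs u i * Real.exp (v i) := by
    rw [Finset.sum_div]
    exact Finset.sum_congr rfl fun i _ => by rw [gibbs, Real.exp_add]; ring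
  have hexp : ∑ i, gibbs u i * Real.exp (v i) ≤ ∑ i, (gibbs u i + gibbs u i * v i + gibbs u i * δ) := by
    refine Finset.sum_le_sum fun i _ => ?_
    have h := (abs_le.1 (Real.abs_exp_sub_one_sub_id_le (h1 i))).2
    have := mul_le_mul_of_nonneg_left (show Real.exp (v i) ≤ 1 + v i + δ by linarith [hδ i])
      (gibbs_nonneg u i)
    linarith
  have hlog := Real.log_le_sub_one_of_pos (div_pos huv hu)
  rw [Real.log_div huv.ne' hu.ne', hratio] at hlog
  rw [Finset.sum_add_distrib, Finset.sum_add_distrib, sum_gibbs, ← Finset.sum_mul, sum_gibbs] at hexp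
  linarith

/-- Used only to bound the potential on records of given length, which makes it integrable. -/
theorem abs_log_sum_exp_le [Nonempty ι] {u : ι → ℝ} {A : ℝ} (hu : ∀ i, |u i| ≤ A) :
    |Real.log (∑ i, Real.exp (u i))| ≤ Real.log (Fintype.card ι) + A := by
  have hc : (0 : ℝ) < Fintype.card ι := by exact_mod_cast Fintype.card_pos
  have hc1 : (1 : ℝ) ≤ Fintype.card ι := by exact_mod_cast Fintype.card_pos
  have hl := Real.log_nonneg hc1
  have hup : ∑ i, Real.exp (u i) ≤ Fintype.card ι * Real.exp A := by
    simpa using Finset.sum_le_sum fun i (_ : i ∈ Finset.univ) =>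
      Real.exp_le_exp.2 (abs_le.1 (hu i)).2
  have hlo : Fintype.card ι * Real.exp (-A) ≤ ∑ i, Real.exp (u i) := by
    simpa using Finset.sum_le_sum fun i (_ : i ∈ Finset.univ) =>
      Real.exp_le_exp.2 (abs_le.1 (hu i)).1
  have h1 := Real.log_le_log (sum_exp_pos u) hup
  have h2 := Real.log_le_log (by positivity) hlo
  rw [Real.log_mul hc.ne' (Real.exp_pos _).ne', Real.log_exp] at h1 h2
  rw [abs_le]
  constructor <;> linarith

theorem le_log_sum_exp [Nonempty ι] (u : ι → ℝ) (i : ι) :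
    u i ≤ Real.log (∑ j, Real.exp (u j)) := by
  rw [Real.le_log_iff_exp_le (sum_exp_pos u)]
  exact Finset.single_le_sum (f := fun j => Real.exp (u j)) (fun _ _ => (Real.exp_pos _).le)
    (Finset.mem_univ i)

variable [Fintype Y]

open Classical in
/-- Follow the advice `e` of the expert drawn with weights `w`, and explore uniformly with
probability `γ`. -/
noncomputable def mixture (γ : ℝ) (w : ι → ℝ) (e : ι → Y) (a : Y) : ℝ :=
  (1 - γ) * (∑ i, if e i = a then w i else 0) + γ / Fintype.card Y

theorem sum_mixture_mul (γ : ℝ) (w : ι → ℝ) (e : ι → Y) (g : Y → ℝ) :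
    ∑ a, mixture γ w e a * g a =
      (1 - γ) * ∑ i, w i * g (e i) + γ / Fintype.card Y * ∑ a, g a := by
  classical
  simp only [mixture, add_mul, Finset.sum_add_distrib, ← Finset.mul_sum, mul_assoc,
    Finset.sum_mul]
  rw [Finset.sum_comm]
  simp

theorem mixture_ge {γ : ℝ} (hγ : γ ≤ 1) {w : ι → ℝ} (hw : ∀ i, 0 ≤ w i) (e : ι → Y) (a : Y) :
    γ / Fintype.card Y ≤ mixture γ w e a := by
  classical
  have : 0 ≤ ∑ i, if e i = a then w i else 0 := Finset.sum_nonneg fun i _ => by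
    split_ifs
    exacts [hw i, le_rfl]
  have := mul_nonneg (sub_nonneg.2 hγ) this
  simpa [mixture] using this

theorem sum_mixture [Nonempty Y] (γ : ℝ) {w : ι → ℝ} (hw : ∑ i, w i = 1) (e : ι → Y) :
    ∑ a, mixture γ w e a = 1 := by
  have := sum_mixture_mul γ w e fun _ => 1
  have hc : (Fintype.card Y : ℝ) ≠ 0 := by exact_mod_cast Fintype.card_ne_zero
  simp only [mul_one, hw, Finset.sum_const, Finset.card_univ, nsmul_eq_mul] at this
  rw [this]
  field_simp
  ring

/-- The distribution with probabilities `mixture γ (gibbs u) e`. -/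
noncomputable def mixturePMF [Nonempty ι] [Nonempty Y] {γ : ℝ} (hγ : 0 < γ ∧ γ ≤ 1) (u : ι → ℝ)
    (e : ι → Y) : PMF Y :=
  PMF.ofFintype (fun a => ENNReal.ofReal (mixture γ (gibbs u) e a)) <| by
    rw [← ENNReal.ofReal_sum_of_nonneg fun a _ =>
      (div_nonneg hγ.1.le (Nat.cast_nonneg _)).trans (mixture_ge hγ.2 (gibbs_nonneg u) e a),
      sum_mixture γ (sum_gibbs u) e, ENNReal.ofReal_one]

theorem toReal_mixturePMF [Nonempty ι] [Nonempty Y] {γ : ℝ} (hγ : 0 < γ ∧ γ ≤ 1) (u : ι → ℝ)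
    (e : ι → Y) (a : Y) : (mixturePMF hγ u e a).toReal = mixture γ (gibbs u) e a :=
  ENNReal.toReal_ofReal <|
    (div_nonneg hγ.1.le (Nat.cast_nonneg _)).trans (mixture_ge hγ.2 (gibbs_nonneg u) e a)

open Classical in
/-- The importance-weighted estimate of the loss of the advice `b`, when the prediction `p`, drawn
with probability `P p`, has suffered the loss `v`. -/
noncomputable def lossEstimate (P : Y → ℝ) (p : Y) (v : ℝ) (b : Y) : ℝ :=
  if b = p then v / P p else 0

/-- The estimate is unbiased: the probability of drawing `b` cancels the importance weight. -/
theorem sum_mul_lossEstimate {P : Y → ℝ} (hP : ∀ a, P a ≠ 0) (g : Y → ℝ) (b : Y) :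
    ∑ p, P p * lossEstimate P p (g p) b = g b := by
  classical
  simp [lossEstimate, mul_div_cancel₀, hP]

/-- This is the purpose of exploration: a floor on the probabilities caps the importance weights. -/
theorem lossEstimate_mem_Icc [Nonempty Y] {P : Y → ℝ} {γ L v : ℝ} (hγ : 0 < γ)
    (hP : ∀ a, γ / Fintype.card Y ≤ P a) (hv : 0 ≤ v) (hL : v ≤ L) (p b : Y) :
    0 ≤ lossEstimate P p v b ∧ lossEstimate P p v b ≤ L * Fintype.card Y / γ := by
  have hc : (0 : ℝ) < Fintype.card Y := by exact_mod_cast Fintype.card_pos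
  have hpos : 0 < γ / Fintype.card Y := by positivity
  have hPp := hP p
  have hL0 := hv.trans hL
  rw [lossEstimate]
  split_ifs
  · refine ⟨div_nonneg hv (hpos.le.trans hPp), ?_⟩
    calc v / P p ≤ L / (γ / Fintype.card Y) := div_le_div₀ hL0 hL hpos hPp
      _ = _ := by field_simp
  · exact ⟨le_rfl, by positivity⟩

/-- One round of exponential weights with uniform exploration: the expected increase of the
potential, whose second part controls the deviation of the estimates from the losses. -/
theorem potential_step [Nonempty ι] [Nonempty Y] {γ η L : ℝ} (hγ : 0 < γ ∧ γ ≤ 1) (hη : 0 < η)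
    (hηB : η * (L * Fintype.card Y / γ) ≤ 1) (s m : ι → ℝ) (e : ι → Y) {g : Y → ℝ}
    (hg0 : ∀ a, 0 ≤ g a) (hgL : ∀ a, g a ≤ L) {P : Y → ℝ}
    (hP : P = mixture γ (gibbs fun i => -(η * s i)) e) :
    ∑ p, P p * (g p + η⁻¹ * Real.log (∑ i, Real.exp (-(η * (s i + lossEstimate P p (g p) (e i)))))
        + η⁻¹ * Real.log (∑ i, Real.exp (η * (m i + (lossEstimate P p (g p) (e i) - g (e i)))))) ≤
      η⁻¹ * Real.log (∑ i, Real.exp (-(η * s i))) + η⁻¹ * Real.log (∑ i, Real.exp (η * m i)) +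
        (γ * L + 2 * η * (L * Fintype.card Y / γ) ^ 2) := by
  set B := L * Fintype.card Y / γ with hB
  set w := gibbs fun i => -(η * s i) with hw
  set r := gibbs fun i => η * m i with hr
  have hc : (1 : ℝ) ≤ Fintype.card Y := by exact_mod_cast Fintype.card_pos
  have hPge : ∀ a, γ / Fintype.card Y ≤ P a := fun a => hP ▸ mixture_ge hγ.2 (gibbs_nonneg _) e a
  have hP0 : ∀ a, 0 < P a := fun a => (div_pos hγ.1 (by linarith)).trans_le (hPge a)
  have hP1 : ∑ a, P a = 1 := hP ▸ sum_mixture γ (sum_gibbs _) e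
  have hL0 : 0 ≤ L := (hg0 (Classical.arbitrary Y)).trans (hgL _)
  -- Since `γ ≤ 1 ≤ |Y|`. This keeps estimate minus loss, which lies in `[-L, B]`, within `[-B, B]`.
  have hLB : L ≤ B := by
    rw [hB, le_div_iff₀ hγ.1]
    nlinarith [hγ.2]
  have hest := fun p b => lossEstimate_mem_Icc hγ.1 hPge (hg0 p) (hgL p) p b
  have hmul : ∀ x, |x| ≤ B → |η * x| ≤ 1 ∧ (η * x) ^ 2 ≤ η ^ 2 * B ^ 2 := fun x hx => by
    rw [abs_mul, abs_of_pos hη, mul_pow]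
    exact ⟨(mul_le_mul_of_nonneg_left hx hη.le).trans hηB,
      mul_le_mul_of_nonneg_left (sq_le_sq' (abs_le.1 hx).1 (abs_le.1 hx).2) (sq_nonneg _)⟩
  -- Second-order bounds on both logarithms, with Gibbs weights `w` for the estimates and `r` for
  -- the deviations; each contributes an error `η * B ^ 2`.
  have hround : ∀ p, g p +
        η⁻¹ * Real.log (∑ i, Real.exp (-(η * (s i + lossEstimate P p (g p) (e i))))) +
        η⁻¹ * Real.log (∑ i, Real.exp (η * (m i + (lossEstimate P p (g p) (e i) - g (e i))))) ≤
      g p + (η⁻¹ * Real.log (∑ i, Real.exp (-(η * s i))) +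
        η⁻¹ * Real.log (∑ i, Real.exp (η * m i)) + 2 * η * B ^ 2) +
      ∑ i, (r i - w i) * lossEstimate P p (g p) (e i) - ∑ i, r i * g (e i) := fun p => by
    have h1 := log_sum_exp_add_le (fun i => -(η * s i))
      (fun i => η * -lossEstimate P p (g p) (e i)) (δ := η ^ 2 * B ^ 2)
      (fun i => (hmul _ (by rw [abs_neg, abs_of_nonneg (hest _ _).1]; exact (hest _ _).2)).1)
      (fun i => (hmul _ (by rw [abs_neg, abs_of_nonneg (hest _ _).1]; exact (hest _ _).2)).2)
    have hdev : ∀ i, |lossEstimate P p (g p) (e i) - g (e i)| ≤ B := fun i => by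
      rw [abs_le]
      constructor <;> linarith [hest p (e i), hg0 (e i), hgL (e i), (hest p (e i)).1, (hest p (e i)).2]
    have h2 := log_sum_exp_add_le (fun i => η * m i)
      (fun i => η * (lossEstimate P p (g p) (e i) - g (e i))) (δ := η ^ 2 * B ^ 2)
      (fun i => (hmul _ (hdev i)).1) (fun i => (hmul _ (hdev i)).2)
    rw [← hw] at h1
    rw [← hr] at h2
    have e1 : ∀ i, -(η * s i) + η * -lossEstimate P p (g p) (e i) =
        -(η * (s i + lossEstimate P p (g p) (e i))) := fun i => by ring
    simp only [e1] at h1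
    simp only [← mul_add] at h2
    have h1' := mul_le_mul_of_nonneg_left h1 (inv_pos.2 hη).le
    have h2' := mul_le_mul_of_nonneg_left h2 (inv_pos.2 hη).le
    have e2 : η⁻¹ * (∑ i, w i * (η * -lossEstimate P p (g p) (e i)) + η ^ 2 * B ^ 2) =
        -∑ i, w i * lossEstimate P p (g p) (e i) + η * B ^ 2 := by
      rw [mul_add, Finset.mul_sum, ← Finset.sum_neg_distrib]
      congr 1
      · exact Finset.sum_congr rfl fun i _ => by field_simp
      · field_simp
    have e3 : η⁻¹ * (∑ i, r i * (η * (lossEstimate P p (g p) (e i) - g (e i))) + η ^ 2 * B ^ 2) =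
        ∑ i, r i * lossEstimate P p (g p) (e i) - ∑ i, r i * g (e i) + η * B ^ 2 := by
      rw [mul_add, Finset.mul_sum, ← Finset.sum_sub_distrib]
      congr 1
      · exact Finset.sum_congr rfl fun i _ => by field_simp
      · field_simp
    rw [mul_add _ (Real.log _), e2] at h1'
    rw [mul_add _ (Real.log _), e3] at h2'
    simp only [sub_mul, Finset.sum_sub_distrib]
    linarith
  have hmean : ∑ p, P p * g p ≤ ∑ i, w i * g (e i) + γ * L := by
    rw [hP, sum_mixture_mul]
    have h1 : 0 ≤ ∑ i, w i * g (e i) :=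
      Finset.sum_nonneg fun i _ => mul_nonneg (gibbs_nonneg _ i) (hg0 _)
    have h2 : ∑ a, g a ≤ Fintype.card Y * L := by
      simpa using Finset.sum_le_sum fun a (_ : a ∈ Finset.univ) => hgL a
    have h3 : γ / Fintype.card Y * ∑ a, g a ≤ γ / Fintype.card Y * (Fintype.card Y * L) :=
      mul_le_mul_of_nonneg_left h2 (div_nonneg hγ.1.le (by linarith))
    rw [← mul_assoc, div_mul_cancel₀ _ (by linarith)] at h3
    nlinarith [hγ.1]
  -- By unbiasedness the linear terms of `hround` average to `∑ (r - w) g - ∑ r g = -∑ w g`, which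
  -- cancels the learner's mean loss in `hmean` up to `γ * L`.
  have hunb : ∑ p, P p * ∑ i, (r i - w i) * lossEstimate P p (g p) (e i) =
      ∑ i, (r i - w i) * g (e i) := by
    simp only [Finset.mul_sum]
    rw [Finset.sum_comm]
    refine Finset.sum_congr rfl fun i _ => ?_
    rw [← sum_mul_lossEstimate (fun a => (hP0 a).ne') g (e i), Finset.mul_sum]
    exact Finset.sum_congr rfl fun p _ => by ring
  refine (Finset.sum_le_sum fun p _ => mul_le_mul_of_nonneg_left (hround p) (hP0 p).le).trans ?_
  simp only [mul_add, mul_sub, Finset.sum_add_distrib, Finset.sum_sub_distrib, ← Finset.sum_mul, hP1,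
    hunb] at *
  simp only [sub_mul, Finset.sum_sub_distrib]
  linarith

end ExponentialWeights

/-! ### True cumulative losses of the experts -/

section Experts

variable {X Y : Type*}

theorem map_inst_toBandit (loss : Y → Y → ℝ) (h : List (Round X Y)) :
    (h.map (Round.toBandit loss)).map BanditRound.inst = h.map Round.inst := by
  simp [Round.toBandit]

/-- The cumulative loss of an expert. -/
noncomputable def expertLoss (loss : Y → Y → ℝ) (e : List X → X → Y) (h : List (Round X Y)) : ℝ :=
  (h.foldl (fun st r => (st.1 ++ [r.inst], st.2 + loss (e st.1 r.inst) r.label))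
    (([] : List X), (0 : ℝ))).2

theorem expertLoss_append (loss : Y → Y → ℝ) (e : List X → X → Y) (h : List (Round X Y))
    (r : Round X Y) :
    expertLoss loss e (h ++ [r]) =
      expertLoss loss e h + loss (e (h.map Round.inst) r.inst) r.label := by
  have hfst : ∀ h : List (Round X Y),
      (h.foldl (fun st r => (st.1 ++ [r.inst], st.2 + loss (e st.1 r.inst) r.label))
        (([] : List X), (0 : ℝ))).1 = h.map Round.inst := fun h => by
    induction h using List.reverseRecOn with
    | nil => rfl
    | append_singleton h r ih => simp [List.foldl_append, ih]
  simp [expertLoss, List.foldl_append, hfst]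

theorem expertLoss_eq_of_follows (loss : Y → Y → ℝ) {e : List X → X → Y} {f : X → Y}
    {h : List (Round X Y)} (he : ∀ l x, l ++ [x] <+: h.map Round.inst → e l x = f x) :
    expertLoss loss e h = (h.map fun r => loss (f r.inst) r.label).sum := by
  induction h using List.reverseRecOn with
  | nil => rfl
  | append_singleton h r ih =>
    rw [expertLoss_append, ih fun l x hl => he l x (hl.trans (by simp)), he _ _ (by simp)]
    simp

theorem abs_expertLoss_le {loss : Y → Y → ℝ} {L : ℝ} (h0 : ∀ a b, 0 ≤ loss a b) (hL : ∀ a b, loss a b ≤ L)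
    (e : List X → X → Y) (h : List (Round X Y)) : |expertLoss loss e h| ≤ h.length * L := by
  induction h using List.reverseRecOn with
  | nil => simp [expertLoss]
  | append_singleton h r ih =>
    rw [expertLoss_append]
    refine (abs_add_le _ _).trans ?_
    rw [List.length_append, List.length_singleton, Nat.cast_add, Nat.cast_one, add_one_mul]
    exact add_le_add ih ((abs_of_nonneg (h0 _ _)).trans_le (hL _ _))

end Experts

/-! ### Regret of the bandit learner -/

section BanditUpperBound

variable {X Y ι : Type*} [Fintype ι] [Fintype Y]

/-- The internal state of the bandit learner: the past instances, and the estimated cumulative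
losses of the experts. -/
noncomputable def expertState (γ η : ℝ) (E : ι → List X → X → Y) (h : List (BanditRound X Y)) :
    List X × (ι → ℝ) :=
  h.foldl (fun st r => (st.1 ++ [r.inst], fun i => st.2 i +
    lossEstimate (mixture γ (gibbs fun j => -(η * st.2 j)) fun j => E j st.1 r.inst)
      r.pred r.lossValue (E i st.1 r.inst))) ([], 0)

theorem expertState_fst (γ η : ℝ) (E : ι → List X → X → Y) (h : List (BanditRound X Y)) :
    (expertState γ η E h).1 = h.map BanditRound.inst := by
  induction h using List.reverseRecOn with
  | nil => rfl
  | append_singleton h r ih =>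
    rw [expertState, List.foldl_append, ← expertState]
    simp [ih]

/-- The estimated cumulative loss of an expert. -/
noncomputable def estimatedLoss (loss : Y → Y → ℝ) (γ η : ℝ) (E : ι → List X → X → Y)
    (h : List (Round X Y)) : ι → ℝ :=
  (expertState γ η E (h.map (Round.toBandit loss))).2

/-- The law of the prediction of the bandit learner, after the record `h`, at the instance `x`. -/
noncomputable def predictionWeight (loss : Y → Y → ℝ) (γ η : ℝ) (E : ι → List X → X → Y)
    (h : List (Round X Y)) (x : X) : Y → ℝ :=
  mixture γ (gibbs fun j => -(η * estimatedLoss loss γ η E h j)) fun j => E j (h.map Round.inst) x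

/-- Rewrites the learner's update, computed from the bandit view alone, in terms of the full record
used in the analysis. -/
theorem estimatedLoss_append (loss : Y → Y → ℝ) (γ η : ℝ) (E : ι → List X → X → Y)
    (h : List (Round X Y)) (r : Round X Y) (i : ι) :
    estimatedLoss loss γ η E (h ++ [r]) i = estimatedLoss loss γ η E h i +
      lossEstimate (predictionWeight loss γ η E h r.inst) r.pred (loss r.pred r.label)
        (E i (h.map Round.inst) r.inst) := by
  rw [estimatedLoss, List.map_append, expertState, List.foldl_append, ← expertState]
  simp only [List.map_cons, List.map_nil, List.foldl_cons, List.foldl_nil, expertState_fst,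
    map_inst_toBandit]
  rfl

/-- Exponential weights over the experts `E`, mixed with uniform exploration. -/
noncomputable def exponentialWeights [Nonempty ι] [Nonempty Y] {γ : ℝ} (hγ : 0 < γ ∧ γ ≤ 1)
    (η : ℝ) (E : ι → List X → X → Y) : BanditLearner X Y := fun h x =>
  mixturePMF hγ (fun i => -(η * (expertState γ η E h).2 i)) fun i => E i (expertState γ η E h).1 x

theorem exponentialWeights_toReal [Nonempty ι] [Nonempty Y] (loss : Y → Y → ℝ) {γ : ℝ}
    (hγ : 0 < γ ∧ γ ≤ 1) (η : ℝ) (E : ι → List X → X → Y) (h : List (Round X Y)) (x : X) (p : Y) :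
    ((exponentialWeights hγ η E).toLearner loss h x p).toReal =
      predictionWeight loss γ η E h x p := by
  rw [BanditLearner.toLearner, exponentialWeights, toReal_mixturePMF, expertState_fst,
    map_inst_toBandit]
  rfl

/-- The potential that bounds the regret from above. -/
noncomputable def regretPotential (loss : Y → Y → ℝ) (γ η : ℝ) (E : ι → List X → X → Y)
    (h : List (Round X Y)) : ℝ :=
  cumLoss loss h + η⁻¹ * Real.log (∑ i, Real.exp (-(η * estimatedLoss loss γ η E h i))) +
    η⁻¹ * Real.log (∑ i, Real.exp (η * (estimatedLoss loss γ η E h i - expertLoss loss (E i) h)))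

variable {loss : Y → Y → ℝ} {γ η L : ℝ}

section

variable [Nonempty Y]

theorem abs_estimatedLoss_le (h0 : ∀ a b, 0 ≤ loss a b) (hL : ∀ a b, loss a b ≤ L)
    (hγ : 0 < γ ∧ γ ≤ 1) (E : ι → List X → X → Y) (h : List (Round X Y)) (i : ι) :
    |estimatedLoss loss γ η E h i| ≤ h.length * (L * Fintype.card Y / γ) := by
  induction h using List.reverseRecOn with
  | nil => simp [estimatedLoss, expertState]
  | append_singleton h r ih =>
    rw [estimatedLoss_append]
    obtain ⟨h1, h2⟩ := lossEstimate_mem_Icc hγ.1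
      (fun a => mixture_ge hγ.2 (gibbs_nonneg fun j => -(η * estimatedLoss loss γ η E h j))
        (fun j => E j (h.map Round.inst) r.inst) a)
      (h0 r.pred r.label) (hL _ _) r.pred (E i (h.map Round.inst) r.inst)
    refine (abs_add_le _ _).trans ?_
    rw [List.length_append, List.length_singleton, Nat.cast_add, Nat.cast_one, add_one_mul]
    exact add_le_add ih ((abs_of_nonneg h1).trans_le h2)

end

variable [Nonempty ι]

/-- For the expert following `f`, the two logarithmic terms are at least minus its estimated loss
and its estimated minus true loss. The estimates cancel, leaving minus the true loss of `f`. -/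
theorem regret_le_regretPotential (hη : 0 < η) {E : ι → List X → X → Y} {F : Set (X → Y)}
    (hF : F.Nonempty) {h : List (Round X Y)} (hE : Covers E F h.length) :
    regret loss F h ≤ regretPotential loss γ η E h := by
  obtain ⟨f₀, hf₀⟩ := hF
  have : Nonempty F := ⟨⟨f₀, hf₀⟩⟩
  have key : cumLoss loss h - regretPotential loss γ η E h ≤
      ⨅ f : F, (h.map fun r => loss (f.1 r.inst) r.label).sum := by
    refine le_ciInf fun f => ?_
    obtain ⟨i, hi⟩ := hE f.1 f.2 (h.map Round.inst) (by simp)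
    rw [← expertLoss_eq_of_follows loss hi]
    have h1 := mul_le_mul_of_nonneg_left
      (le_log_sum_exp (fun i => -(η * estimatedLoss loss γ η E h i)) i) (inv_pos.2 hη).le
    have h2 := mul_le_mul_of_nonneg_left
      (le_log_sum_exp (fun i => η * (estimatedLoss loss γ η E h i - expertLoss loss (E i) h)) i)
      (inv_pos.2 hη).le
    rw [← mul_neg, inv_mul_cancel_left₀ hη.ne'] at h1
    rw [inv_mul_cancel_left₀ hη.ne'] at h2
    rw [regretPotential]
    linarith
  rw [regret, ← cumLoss]
  linarith

variable [Nonempty Y]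

theorem lengthBounded_regretPotential (h0 : ∀ a b, 0 ≤ loss a b) (hL : ∀ a b, loss a b ≤ L)
    (hγ : 0 < γ ∧ γ ≤ 1) (hη : 0 < η) (E : ι → List X → X → Y) :
    LengthBounded (regretPotential loss γ η E) := by
  intro n
  obtain ⟨C, hC⟩ := lengthBounded_cumLoss (X := X) h0 hL n
  set B := L * Fintype.card Y / γ with hB
  refine ⟨C + η⁻¹ * (Real.log (Fintype.card ι) + η * (n * B)) +
    η⁻¹ * (Real.log (Fintype.card ι) + η * (n * B + n * L)), fun h hh => ?_⟩
  have h1 := abs_estimatedLoss_le (η := η) h0 hL hγ E h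
  have h2 := fun i => abs_expertLoss_le h0 hL (E i) h
  rw [hh] at h1 h2
  refine (abs_add_le _ _).trans (add_le_add ((abs_add_le _ _).trans (add_le_add (hC h hh) ?_)) ?_)
  all_goals
    rw [abs_mul, abs_of_pos (inv_pos.2 hη)]
    refine mul_le_mul_of_nonneg_left (abs_log_sum_exp_le fun i => ?_) (inv_pos.2 hη).le
  · rw [abs_neg, abs_mul, abs_of_pos hη]
    exact mul_le_mul_of_nonneg_left (h1 i) hη.le
  · rw [abs_mul, abs_of_pos hη]
    exact mul_le_mul_of_nonneg_left ((abs_sub _ _).trans (add_le_add (h1 i) (h2 i))) hη.le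

/-- The potential starts at `2 * η⁻¹ * log |ι|`, both sums being over zero exponents, and grows per
round as in `potential_step`. -/
theorem expectedRegret_exponentialWeights_le (h0 : ∀ a b, 0 ≤ loss a b)
    (hL : ∀ a b, loss a b ≤ L) (hγ : 0 < γ ∧ γ ≤ 1) (hη : 0 < η)
    (hηB : η * (L * Fintype.card Y / γ) ≤ 1) {E : ι → List X → X → Y} {F : Set (X → Y)}
    (hF : F.Nonempty) {T : ℕ} (hE : Covers E F T) (D : Adversary X Y) :
    expectedRegret loss F ((exponentialWeights hγ η E).toLearner loss) D T ≤
      2 * η⁻¹ * Real.log (Fintype.card ι) +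
        T * (γ * L + 2 * η * (L * Fintype.card Y / γ) ^ 2) := by
  set A := (exponentialWeights hγ η E).toLearner loss with hA
  have hV := lengthBounded_regretPotential h0 hL hγ hη E
  have hmono : expectedRegret loss F A D T ≤
      expect (gameLaw A D T) (regretPotential loss γ η E) := by
    refine expect_mono ((lengthBounded_regret h0 hL hF).bddOnSupport A D T)
      (hV.bddOnSupport A D T) fun h hh => regret_le_regretPotential hη hF ?_
    rwa [length_of_mem_support_gameLaw hh]
  refine hmono.trans ((expect_gameLaw_le hV A D
    (ε := γ * L + 2 * η * (L * Fintype.card Y / γ) ^ 2) (fun h x y => ?_) T).trans_eq ?_)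
  · have hstep := potential_step hγ hη hηB (estimatedLoss loss γ η E h)
      (fun i => estimatedLoss loss γ η E h i - expertLoss loss (E i) h)
      (fun i => E i (h.map Round.inst) x) (fun a => h0 a y) (fun a => hL a y)
      (P := predictionWeight loss γ η E h x) rfl
    have hsum : ∑ p, predictionWeight loss γ η E h x p = 1 := sum_mixture _ (sum_gibbs _) _
    rw [expect_fintype]
    simp only [hA, exponentialWeights_toReal]
    calc _ = cumLoss loss h * ∑ p, predictionWeight loss γ η E h x p + _ := by
            rw [Finset.mul_sum, ← Finset.sum_add_distrib]
            refine Finset.sum_congr rfl fun p _ => ?_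
            rw [mul_comm (cumLoss loss h), ← mul_add]
            congr 1
            simp only [regretPotential, cumLoss_append, estimatedLoss_append, expertLoss_append]
            simp only [add_sub_add_comm]
            rw [add_assoc (cumLoss loss h), add_assoc (cumLoss loss h)]
      _ ≤ _ := by
            rw [hsum, mul_one, regretPotential]
            linarith
  · simp [regretPotential, cumLoss, estimatedLoss, expertState, expertLoss]
    ring

end BanditUpperBound

/-! ### Choice of parameters and sublinearity -/

section Rate

/-- With `v = (T + 1) ^ (1 / 8)`, `v ^ 7` is `T + 1` divided by `v`, and `v` tends to infinity. -/
theorem isRegretBound_rpow {c : ℝ} (hc : 0 < c) :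
    IsRegretBound fun T : ℕ => c * (((T : ℝ) + 1) ^ (1 / 8 : ℝ)) ^ 7 where
  pos T := by positivity
  mono a b hab := by
    have : (a : ℝ) ≤ b := by exact_mod_cast hab
    dsimp only
    gcongr
  sublinear := by
    have hu : Filter.Tendsto (fun T : ℕ => (((T : ℝ) + 1) ^ (1 / 8 : ℝ))⁻¹) Filter.atTop (nhds 0) :=
      ((tendsto_rpow_atTop (by norm_num)).comp
        (Filter.tendsto_atTop_add_const_right _ 1 tendsto_natCast_atTop_atTop)).inv_tendsto_atTop
    have h1 : (fun T : ℕ => (T : ℝ) + 1) =O[Filter.atTop] fun T : ℕ => (T : ℝ) := by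
      refine Asymptotics.IsBigO.of_bound 2 ?_
      filter_upwards [Filter.eventually_ge_atTop 1] with T hT
      have : (1 : ℝ) ≤ T := by exact_mod_cast hT
      rw [Real.norm_of_nonneg (by positivity), Real.norm_of_nonneg (by positivity)]
      linarith
    have h2 := ((Asymptotics.isLittleO_one_iff ℝ).2 hu).mul_isBigO h1
    simp only [one_mul] at h2
    refine (h2.const_mul_left c).congr_left fun T => ?_
    have hpos : 0 < ((T : ℝ) + 1) ^ (1 / 8 : ℝ) := by positivity
    have h8 : (T : ℝ) + 1 = (((T : ℝ) + 1) ^ (1 / 8 : ℝ)) ^ 8 := by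
      rw [← Real.rpow_natCast, ← Real.rpow_mul (by positivity)]
      norm_num
    generalize ((T : ℝ) + 1) ^ (1 / 8 : ℝ) = v at *
    rw [h8]
    field_simp

/-- A nonempty class with polynomial covers is bandit learnable. -/
theorem banditOnlineLearnable_of_hasPolyCover {X Y : Type*} [Finite Y] [Nonempty Y]
    {loss : Y → Y → ℝ} (h0 : ∀ a b, 0 ≤ loss a b) {F : Set (X → Y)} (hF : F.Nonempty)
    (hcov : HasPolyCover F) (𝒟 : Set (Adversary X Y)) : BanditOnlineLearnable 𝒟 loss F := by
  have := Fintype.ofFinite Y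
  obtain ⟨C, d, hcov⟩ := hcov
  choose ι i1 i2 E hcard hE using hcov
  -- Taking `L ≥ 1` keeps `M` positive even when the loss vanishes identically.
  obtain ⟨L, hL1, hL⟩ : ∃ L : ℝ, 1 ≤ L ∧ ∀ a b, loss a b ≤ L := by
    obtain ⟨L, hL⟩ := (Set.finite_range fun p : Y × Y => loss p.1 p.2).bddAbove
    exact ⟨max 1 L, le_max_left _ _, fun a b => (hL ⟨(a, b), rfl⟩).trans (le_max_right _ _)⟩
  have hc : (1 : ℝ) ≤ Fintype.card Y := by exact_mod_cast Fintype.card_pos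
  set M := L * Fintype.card Y with hM
  have hM1 : 1 ≤ M := one_le_mul_of_one_le_of_one_le hL1 hc
  let u : ℕ → ℝ := fun T => ((T : ℝ) + 1) ^ (1 / 8 : ℝ)
  have hu1 : ∀ T, 1 ≤ u T := fun T =>
    Real.one_le_rpow (by linarith [Nat.cast_nonneg (α := ℝ) T]) (by norm_num)
  have hu8 : ∀ T, u T ^ 8 = (T : ℝ) + 1 := fun T => by
    rw [← Real.rpow_natCast, ← Real.rpow_mul (by positivity)]
    norm_num
  have hγ : ∀ T, 0 < (u T)⁻¹ ∧ (u T)⁻¹ ≤ 1 := fun T =>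
    ⟨inv_pos.2 (by linarith [hu1 T]), inv_le_one_of_one_le₀ (hu1 T)⟩
  -- With `γ = u⁻¹` the estimates are at most `M u`, and `η = (M u ^ 4)⁻¹` makes `η B = u⁻³ ≤ 1`.
  -- Over `T ≤ u ^ 8` rounds exploration costs order `u ^ 7` and the second-order error order `u ^
  -- 6`; the initial potential is of order `u ^ 4` times `log |ι|`.
  refine ⟨fun T => exponentialWeights (hγ T) (M * u T ^ 4)⁻¹ (E T),
    fun T => (2 * M * d * (C + 8) + L + 2 * M) * u T ^ 7,
    isRegretBound_rpow (by positivity), fun T D _ => ?_⟩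
  have hu := hu1 T
  have hu0 : 0 < u T := by linarith
  have hB : L * Fintype.card Y / (u T)⁻¹ = M * u T := by rw [div_inv_eq_mul]
  have hηB : (M * u T ^ 4)⁻¹ * (L * Fintype.card Y / (u T)⁻¹) ≤ 1 := by
    rw [hB, inv_mul_le_iff₀ (by positivity), mul_one]
    gcongr
    exact le_self_pow₀ hu (by norm_num)
  refine (expectedRegret_exponentialWeights_le h0 hL (hγ T) (by positivity) hηB hF (hE T) D).trans ?_
  rw [hB, inv_inv]
  -- Uses `log (C + 1) ≤ C` and `log u ≤ u - 1`; `C + 1` in place of `C` keeps the base positive.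
  have hlog : Real.log (Fintype.card (ι T)) ≤ d * (C + 8) * u T := by
    have h1 : (Fintype.card (ι T) : ℝ) ≤ ((C + 1) * u T ^ 8) ^ d := by
      rw [hu8]
      refine (Nat.cast_le.2 (hcard T)).trans ?_
      push_cast
      gcongr
      linarith
    have h2 := Real.log_le_log (by exact_mod_cast Fintype.card_pos) h1
    rw [Real.log_pow, Real.log_mul (by positivity) (by positivity), Real.log_pow] at h2
    have h3 := Real.log_le_sub_one_of_pos (show (0 : ℝ) < C + 1 by positivity)
    have h4 := Real.log_le_sub_one_of_pos hu0
    refine h2.trans ?_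
    rw [mul_assoc]
    gcongr
    push_cast
    nlinarith [Nat.cast_nonneg (α := ℝ) C]
  have hT : (T : ℝ) ≤ u T ^ 8 := by rw [hu8]; linarith
  have hpen : (u T)⁻¹ * L + 2 * (M * u T ^ 4)⁻¹ * (M * u T) ^ 2 ≤ (L + 2 * M) * (u T)⁻¹ := by
    have : 2 * (M * u T ^ 4)⁻¹ * (M * u T) ^ 2 = 2 * M * ((u T)⁻¹ * (u T)⁻¹) := by field_simp
    rw [this]
    have := mul_le_mul_of_nonneg_left (hγ T).2 (hγ T).1.le
    nlinarith
  calc _ ≤ 2 * (M * u T ^ 4) * (d * (C + 8) * u T) + u T ^ 8 * ((L + 2 * M) * (u T)⁻¹) := by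
        gcongr
    _ = 2 * M * d * (C + 8) * u T ^ 5 + (L + 2 * M) * u T ^ 7 := by field_simp
    _ ≤ 2 * M * d * (C + 8) * u T ^ 7 + (L + 2 * M) * u T ^ 7 := by
        gcongr
        norm_num
    _ = _ := by ring

end Rate

/-! ### The equivalence through covers -/

section Equivalence

variable {X Y : Type*}

theorem BanditOnlineLearnable.onlineLearnable {C : Set (Adversary X Y)} {loss : Y → Y → ℝ}
    {F : Set (X → Y)} (h : BanditOnlineLearnable C loss F) : OnlineLearnable C loss F := by
  obtain ⟨B, R, hR, hB⟩ := h
  exact ⟨fun T => (B T).toLearner loss, R, hR, hB⟩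

theorem OnlineLearnable.anti {C C' : Set (Adversary X Y)} {loss : Y → Y → ℝ}
    {F : Set (X → Y)} (h : OnlineLearnable C loss F) (hC : C' ⊆ C) : OnlineLearnable C' loss F := by
  obtain ⟨A, R, hR, hA⟩ := h
  exact ⟨A, R, hR, fun T D hD => hA T D (hC hD)⟩

/-- Learnability, against any class of adversaries that contains the oblivious ones, yields
polynomial covers. -/
theorem OnlineLearnable.hasPolyCover [Finite Y] [Nonempty Y] {C : Set (Adversary X Y)}
    (hC : obliviousAdversaries X Y ⊆ C) {loss : Y → Y → ℝ} (h0 : ∀ a b, 0 ≤ loss a b)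
    (hi : IdentityOfIndiscernibles loss) {F : Set (X → Y)} (h : OnlineLearnable C loss F) :
    HasPolyCover F := by
  obtain ⟨d, hd⟩ := exists_not_shatters_of_onlineLearnable h0 hi (h.anti hC)
  exact hasPolyCover_of_not_shatters hd

theorem zeroOneLoss_nonneg (a b : Y) : 0 ≤ zeroOneLoss a b := by
  unfold zeroOneLoss
  split_ifs <;> norm_num

theorem identityOfIndiscernibles_zeroOneLoss :
    IdentityOfIndiscernibles (zeroOneLoss (Y := Y)) := fun a b => by
  simp [zeroOneLoss]

/-- The lower bound needs only oblivious adversaries and the upper bound holds against all of them,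
so `C` and `C'` may be any classes containing the oblivious ones, chosen independently. -/
theorem banditOnlineLearnable_iff_forall_coordClass {K : ℕ}
    {loss : MultiLabel K → MultiLabel K → ℝ} (h0 : ∀ a b, 0 ≤ loss a b)
    (hi : IdentityOfIndiscernibles loss) {F : Set (X → MultiLabel K)} (hF : F.Nonempty)
    {C : Set (Adversary X (MultiLabel K))} {C' : Set (Adversary X ℤˣ)}
    (hC : obliviousAdversaries X (MultiLabel K) ⊆ C) (hC' : obliviousAdversaries X ℤˣ ⊆ C') :
    BanditOnlineLearnable C loss F ↔
      ∀ k : Fin K, OnlineLearnable C' zeroOneLoss (coordClass F k) := by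
  constructor
  · intro h k
    obtain ⟨f, hf⟩ := hF
    have hne : (coordClass F k).Nonempty := ⟨fun x => f x k, f, hf, rfl⟩
    exact (banditOnlineLearnable_of_hasPolyCover zeroOneLoss_nonneg hne
      ((h.onlineLearnable.hasPolyCover hC h0 hi).coordClass k) C').onlineLearnable
  · intro h
    exact banditOnlineLearnable_of_hasPolyCover h0 hF (hasPolyCover_of_coordClass fun k =>
      (h k).hasPolyCover hC' zeroOneLoss_nonneg identityOfIndiscernibles_zeroOneLoss) C

end Equivalence

end OnlineLearning

theorem mainTheorem11 {X : Type*} {K : ℕ}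
    (loss : OnlineLearning.MultiLabel K → OnlineLearning.MultiLabel K → ℝ)
    (loss_nonneg : ∀ y₁ y₂, 0 ≤ loss y₁ y₂)
    (loss_indisc : OnlineLearning.IdentityOfIndiscernibles loss)
    (F : Set (X → OnlineLearning.MultiLabel K)) (hF : F.Nonempty) :
    (OnlineLearning.BanditOnlineLearnable
        (OnlineLearning.adaptiveAdversaries X (OnlineLearning.MultiLabel K)) loss F ↔
      ∀ k : Fin K, OnlineLearning.OnlineLearnable
        (OnlineLearning.adaptiveAdversaries X ℤˣ) OnlineLearning.zeroOneLoss
        (OnlineLearning.coordClass F k)) ∧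
    (OnlineLearning.BanditOnlineLearnable
        (OnlineLearning.obliviousAdversaries X (OnlineLearning.MultiLabel K)) loss F ↔
      ∀ k : Fin K, OnlineLearning.OnlineLearnable
        (OnlineLearning.obliviousAdversaries X ℤˣ) OnlineLearning.zeroOneLoss
        (OnlineLearning.coordClass F k)) := by
  exact ⟨OnlineLearning.banditOnlineLearnable_iff_forall_coordClass loss_nonneg loss_indisc hF
      (Set.subset_univ _) (Set.subset_univ _),
    OnlineLearning.banditOnlineLearnable_iff_forall_coordClass loss_nonneg loss_indisc hF
      subset_rfl subset_rfl⟩
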